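/- A topological graph is a (nonempty) compact connected metric space $X$ together with a finite family of arcs $(A_i)_{i\in I}$ (subspaces homeomorphic to $[0,1]$) such that $X=\bigcup_{i\in I}A_i$ and, for $i\ne j$, every point of $A_i\cap A_j$ is an end point of both $A_i$ and $A_j$ (the end points of an arc being the points corresponding to $0$ and $1$). The vertices of $X$ are the end points of the arcs $A_i$, and the degree of a vertex $v$ is the number of $i\in I$ such that $v$ is an end point of $A_i$. For a group $G$ acting on $X$ by homeomorphisms, a nonempty set $Y\subseteq X$ is invariant if $gy\in Y$ for all $g\in G$, $y\in Y$. The height of $(G,X)$ is $$h(G,X)=\sup\{n\ge 0:\text{ there are closed invariant sets } Y_0\subsetneq Y_1\subsetneq\cdots\subsetneq Y_n=X\}\in\{0,1,2,\ldots\}\cup\{+\infty\},$$ and $P_h(X)=\{h(G,X): G \text{ is a subgroup of } \mathrm{Homeo}(X)\}$, where $\mathrm{Homeo}(X)$ is the group of all homeomorphisms $X\to X$; equivalently, $P_h(X)$ is the set of heights of all actions of (discrete) groups on $X$ by homeomorphisms. **Theorem.** For every topological graph $X$ the following statements are equivalent: 1. $X$ is homeomorphic to the unit circle $\mathbb S^1$;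 2. $P_h(X)=\{0,1,2,\ldots\}\cup\{+\infty\}$; 3. $0\in P_h(X)$; 4. every vertex of $X$ has degree $2$. -/

import Mathlib

/-- The tautological action of the group of self-homeomorphisms of `X` on `X`: `f • x = f x`. -/
instance homeoMulAction {X : Type*} [TopologicalSpace X] : MulAction (X ≃ₜ X) X where
  smul f x := f x
  one_smul _ := rfl
  mul_smul _ _ _ := rfl

/-- A presentation of the space `X` as a finite union of arcs (indexed by `ι`), any two of which
meet at most in common end points. Each arc is given by a homeomorphism of `[0,1]` onto it, and
its end points are the images of `0` and `1`. -/
structure ArcDecomposition (ι X : Type*) [TopologicalSpace X] where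
  /-- the parametrizations of the arcs -/
  arc : ι → unitInterval → X
  isEmbedding_arc : ∀ i, Topology.IsEmbedding (arc i)
  iUnion_range_arc : ⋃ i, Set.range (arc i) = Set.univ
  inter_subset_ends : ∀ i j, i ≠ j →
    Set.range (arc i) ∩ Set.range (arc j) ⊆ {arc i 0, arc i 1} ∩ {arc j 0, arc j 1}

namespace ArcDecomposition

variable {ι X : Type*} [TopologicalSpace X]

/-- The vertices are the end points of the arcs. -/
def vertices (Γ : ArcDecomposition ι X) : Set X :=
  {v | ∃ i, v = Γ.arc i 0 ∨ v = Γ.arc i 1}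

/-- The degree of `v` is the number of arcs having `v` as an end point (the two end points of an
arc are distinct, so there are no loops to be counted twice). -/
noncomputable def degree (Γ : ArcDecomposition ι X) (v : X) : ℕ :=
  {i : ι | v = Γ.arc i 0 ∨ v = Γ.arc i 1}.ncard

end ArcDecomposition

/-- `Y` is a closed invariant subset of the transformation group `(G, X)`; invariant subsets are
nonempty by convention. -/
def IsClosedInvariant (G : Type*) {X : Type*} [TopologicalSpace X] [Group G] [MulAction G X]
    (Y : Set X) : Prop :=
  Y.Nonempty ∧ IsClosed Y ∧ ∀ (g : G), ∀ y ∈ Y, g • y ∈ Y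

/-- The height `h(G, X)`: the supremum in `{0, 1, …, +∞}` of the `n` for which there is a strictly
increasing chain `Y₀ ⊂ Y₁ ⊂ ⋯ ⊂ Yₙ = X` of closed invariant subsets. -/
noncomputable def transformationHeight (G X : Type*) [TopologicalSpace X] [Group G]
    [MulAction G X] : ℕ∞ :=
  sSup {h : ℕ∞ | ∃ n : ℕ, h = n ∧ ∃ Y : Fin (n + 1) → Set X,
    StrictMono Y ∧ (∀ k, IsClosedInvariant G (Y k)) ∧ Y (Fin.last n) = Set.univ}

/-- `P_h(X)`: the set of all heights `h(G, X)`, where `G` runs over the subgroups of the group of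
self-homeomorphisms of `X`. -/
def possibleHeights (X : Type*) [TopologicalSpace X] : Set ℕ∞ :=
  {h | ∃ G : Subgroup (X ≃ₜ X), h = transformationHeight G X}

/-- `P_h(X)` is also the set of heights of all transformation groups with phase space `X`: every
group `G` (in any universe) acting on `X` by continuous maps has its height in `P_h(X)`. -/
theorem transformationHeight_mem_possibleHeights (G X : Type*) [TopologicalSpace X] [Group G]
    [MulAction G X] [ContinuousConstSMul G X] :
    transformationHeight G X ∈ possibleHeights X := by
  let φ : G →* (X ≃ₜ X) :=
    { toFun := fun g => Homeomorph.smul g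
      map_one' := by ext x; exact one_smul G x
      map_mul' := fun a b => by ext x; exact mul_smul a b x }
  have key : ∀ Y : Set X, IsClosedInvariant G Y ↔ IsClosedInvariant φ.range Y := by
    intro Y
    refine and_congr_right fun _ => and_congr_right fun _ => ?_
    constructor
    · rintro h ⟨_, g, rfl⟩ y hy
      exact h g y hy
    · intro h g y hy
      exact h ⟨φ g, g, rfl⟩ y hy
  refine ⟨φ.range, ?_⟩
  simp only [transformationHeight, key]

/-! For the circle, give it circumference `n` and cut it by the integer values of the distance to
`0`: points at integer distance and the open pieces between them form `n + 1` classes. The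
homeomorphisms preserving the classes act transitively on each
(`AddCircle.exists_homeomorph_of_pieceIndex_eq`), so invariant sets are unions of classes and the
height is at most `n`; adding the points first and the open pieces afterwards keeps every stage
closed and attains `n`. The rotations give height `0`, the trivial group gives `⊤`.

Conversely, height `0` forbids a nonempty finite set preserved by all homeomorphisms. The
topological order of a point (how few boundary points its small neighbourhoods can have) singles out
vertices of degree at least `3` and those of degree `1`, and both exceptional sets are finite, hence
empty (`degree_eq_two_of_zero_mem_possibleHeights`).

If all degrees are `2`, two arcs with a common end either close up to a circle, which is clopen and
so all of `X`, or merge into one arc; induction on the number of arcs finishes. -/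

section

open Set Filter Topology

/-! ### Heights of groups preserving a finite labelling -/

section Height

variable {X : Type*} [TopologicalSpace X]

theorem Fin.val_add_one_le_of_strictMono {n : ℕ} {f : Fin (n + 1) → ℕ} (hf : StrictMono f)
    (h0 : 0 < f 0) (k : Fin (n + 1)) : (k : ℕ) + 1 ≤ f k := by
  induction k using Fin.induction with
  | zero => simpa [Nat.succ_le_iff] using h0
  | succ i ih =>
    have := hf (Fin.castSucc_lt_succ (i := i))
    simp only [Fin.val_succ, Fin.val_castSucc] at ih ⊢
    omega

/-- The homeomorphisms preserving a function. -/
def homeoStabilizer {L : Type*} (q : X → L) : Subgroup (X ≃ₜ X) where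
  carrier := {g | ∀ z, q (g z) = q z}
  mul_mem' {a b} ha hb z := (ha (b z)).trans (hb z)
  one_mem' _ := rfl
  inv_mem' {a} ha z := by
    have := ha (a⁻¹ z)
    rw [← this]
    exact congrArg q (a.apply_symm_apply z)

/-- Transitivity on fibres makes each invariant set a union of fibres. There are at most `n + 1`
labels and each member of a chain uses at least one more than its predecessor, so the height is at
most `n`; the sets `q ⁻¹' S k` attain it. -/
theorem coe_mem_possibleHeights_of_fibers {n : ℕ} (q : X → ℕ) (hq : ∀ x, q x ≤ n)
    (htrans : ∀ x y, q x = q y → ∃ g : X ≃ₜ X, (∀ z, q (g z) = q z) ∧ g x = y)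
    (S : Fin (n + 1) → Set ℕ) (hmono : StrictMono fun k => q ⁻¹' S k)
    (hclosed : ∀ k, IsClosed (q ⁻¹' S k)) (hne : (q ⁻¹' S 0).Nonempty)
    (hlast : q ⁻¹' S (Fin.last n) = univ) : (n : ℕ∞) ∈ possibleHeights X := by
  refine ⟨homeoStabilizer q, le_antisymm ?_ ?_⟩
  · refine le_sSup ⟨n, rfl, fun k => q ⁻¹' S k, hmono, fun k => ⟨?_, hclosed k, ?_⟩, hlast⟩
    · exact hne.mono (hmono.monotone (Fin.zero_le k))
    · intro g y hy
      change q (g.1 y) ∈ S k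
      rw [g.2 y]
      exact hy
  · refine sSup_le ?_
    rintro _ ⟨m, rfl, Y, hY, hinv, -⟩
    have hsat : ∀ k x, q x ∈ q '' Y k → x ∈ Y k := by
      rintro k x ⟨y, hy, hyx⟩
      obtain ⟨g, hg, rfl⟩ := htrans y x hyx
      exact (hinv k).2.2 ⟨g, hg⟩ y hy
    have hfin : ∀ k, q '' Y k ⊆ Set.Iic n := by
      rintro k _ ⟨y, -, rfl⟩
      exact hq y
    have hf : StrictMono fun k => (q '' Y k).ncard := by
      intro k l hkl
      refine ncard_lt_ncard ⟨image_mono (hY hkl).le, fun h => (hY hkl).not_ge ?_⟩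
        ((finite_Iic n).subset (hfin l))
      intro x hx
      exact hsat k x (h (mem_image_of_mem q hx))
    have h0 : 0 < (q '' Y 0).ncard :=
      (ncard_pos ((finite_Iic n).subset (hfin 0))).2 ((hinv 0).1.image q)
    have h1 := Fin.val_add_one_le_of_strictMono hf h0 (Fin.last m)
    have h2 := ncard_le_ncard (hfin (Fin.last m)) (finite_Iic n)
    have h3 : (Set.Iic n).ncard = n + 1 := by
      rw [← Finset.coe_Iic, ncard_coe_finset, Nat.card_Iic]
    simp only [Fin.val_last] at h1
    exact_mod_cast (by omega : m ≤ n)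

/-- Under the trivial group all nonempty closed sets are invariant, so growing finite sets give
chains of any length. -/
theorem top_mem_possibleHeights [T1Space X] [Infinite X] : (⊤ : ℕ∞) ∈ possibleHeights X := by
  refine ⟨⊥, Eq.symm (ENat.eq_top_iff_forall_ge.2 fun n => ?_)⟩
  refine le_sSup ⟨n, rfl, ?_⟩
  let f := Infinite.natEmbedding X
  let Y : ℕ → Set X := fun k => if k < n then f '' Set.Iic k else univ
  have hYn : Y n = univ := by simp [Y]
  have hlt : ∀ k < n, Y k = f '' Set.Iic k := fun k hk => by simp [Y, hk]
  refine ⟨fun k => Y k, ?_, fun k => ⟨?_, ?_, ?_⟩, hYn⟩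
  · rw [Fin.strictMono_iff_lt_succ]
    intro i
    simp only [Fin.val_castSucc, Fin.val_succ]
    have hi : f (i + 1) ∉ f '' Set.Iic (i : ℕ) := by
      rw [f.injective.mem_set_image]
      simp
    rw [hlt i i.2]
    rcases Nat.lt_or_ge (i + 1) n with h | h
    · rw [hlt _ h]
      exact ⟨image_mono (Set.Iic_subset_Iic.2 (Nat.le_succ _)), fun h' =>
        hi (h' (mem_image_of_mem f (Set.mem_Iic.2 le_rfl)))⟩
    · have : (i : ℕ) + 1 = n := by omega
      rw [this, hYn]
      exact ⟨subset_univ _, fun h' => hi (h' (mem_univ _))⟩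
  · dsimp only [Y]
    split_ifs
    · exact nonempty_Iic.image f
    · exact univ_nonempty
  · dsimp only [Y]
    split_ifs
    · exact ((finite_Iic _).image f).isClosed
    · exact isClosed_univ
  · rintro ⟨g, hg⟩ y hy
    rw [Subgroup.mem_bot] at hg
    subst hg
    exact hy

end Height

/-! ### Homeomorphisms of the circle fixing a given set -/

section AddCircle

open Metric

variable {p : ℝ}

theorem AddCircle.norm_coe_le_abs (x : ℝ) : ‖(x : AddCircle p)‖ ≤ |x| :=
  QuotientAddGroup.norm_mk_le_norm

/-- The displacement is Lipschitz with constant `|c| < 1`, so it cannot cancel a difference `z - w`,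
and solving `g z = w` is a fixed point problem for a contraction. Points of `F` stay put. -/
theorem AddCircle.exists_homeomorph_add_infDist [Fact (0 < p)] (F : Set (AddCircle p)) {c : ℝ}
    (hc : |c| < 1) :
    ∃ g : AddCircle p ≃ₜ AddCircle p, ∀ z, g z = z + ((c * infDist z F : ℝ) : AddCircle p) := by
  have key : ∀ z w : AddCircle p,
      ‖((c * infDist z F - c * infDist w F : ℝ) : AddCircle p)‖ ≤ |c| * ‖z - w‖ := by
    intro z w
    refine (norm_coe_le_abs _).trans ?_
    rw [← mul_sub, abs_mul, ← Real.norm_eq_abs (infDist z F - _), ← dist_eq_norm, ← dist_eq_norm]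
    refine mul_le_mul_of_nonneg_left ?_ (abs_nonneg c)
    simpa using (lipschitz_infDist_pt F).dist_le_mul z w
  let g : AddCircle p → AddCircle p := fun z => z + ((c * infDist z F : ℝ) : AddCircle p)
  have hcont : Continuous g :=
    continuous_id.add ((AddCircle.continuous_mk' p).comp
      (continuous_const.mul (continuous_infDist_pt F)))
  have hinj : Function.Injective g := by
    intro z w h
    have h1 : w - z = ((c * infDist z F - c * infDist w F : ℝ) : AddCircle p) := by
      rw [AddCircle.coe_sub, sub_eq_sub_iff_add_eq_add, add_comm w, add_comm _ z]
      simpa [g, add_comm] using h.symm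
    have h2 := key z w
    rw [← h1, norm_sub_rev] at h2
    have h3 : ‖z - w‖ = 0 := by
      nlinarith [norm_nonneg (z - w)]
    exact sub_eq_zero.1 (norm_eq_zero.1 h3)
  have hsurj : Function.Surjective g := by
    intro w
    have hcontr : ContractingWith ⟨|c|, abs_nonneg c⟩
        (fun z : AddCircle p => w - ((c * infDist z F : ℝ) : AddCircle p)) := by
      refine ⟨hc, LipschitzWith.of_dist_le_mul fun z z' => ?_⟩
      rw [dist_eq_norm, dist_eq_norm, sub_sub_sub_cancel_left, ← AddCircle.coe_sub, norm_sub_rev z]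
      exact key z' z
    obtain ⟨z, hz, -⟩ := hcontr.exists_fixedPoint 0 (edist_ne_top _ _)
    exact ⟨z, (eq_sub_iff_add_eq.1 hz.symm)⟩
  exact ⟨hcont.homeoOfEquivCompactToT2 (f := Equiv.ofBijective g ⟨hinj, hsurj⟩), fun z => rfl⟩

end AddCircle

/-! ### Every finite height occurs on the circle -/

section CircleLabel

open Metric

/-- The index of the piece of `[0, ∞)` containing `a`, where the pieces
`{0}, (0, 1), {1}, (1, 2), …` are numbered from left to right. -/
noncomputable def pieceIndex (a : ℝ) : ℕ := ⌊a⌋₊ + ⌈a⌉₊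

theorem pieceIndex_natCast (m : ℕ) : pieceIndex m = 2 * m := by
  simp [pieceIndex, two_mul]

theorem pieceIndex_le_two_mul_iff {a : ℝ} {m : ℕ} : pieceIndex a ≤ 2 * m ↔ a ≤ m := by
  constructor
  · intro h
    by_contra! ha
    have h1 : m < ⌈a⌉₊ := Nat.lt_ceil.2 ha
    have h2 : m ≤ ⌊a⌋₊ := Nat.le_floor ha.le
    unfold pieceIndex at h
    omega
  · intro h
    have h1 : ⌈a⌉₊ ≤ m := Nat.ceil_le.2 h
    have h2 := Nat.floor_le_ceil a
    unfold pieceIndex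
    omega

theorem eq_natFloor_or_pieceIndex_eq {a : ℝ} (ha : 0 ≤ a) :
    a = ⌊a⌋₊ ∨ ((⌊a⌋₊ : ℝ) < a ∧ a < ⌊a⌋₊ + 1 ∧ pieceIndex a = 2 * ⌊a⌋₊ + 1) := by
  rcases (Nat.floor_le ha).eq_or_lt with h | h
  · exact Or.inl h.symm
  · right
    refine ⟨h, Nat.lt_floor_add_one a, ?_⟩
    have h1 : ⌊a⌋₊ < ⌈a⌉₊ := Nat.lt_ceil.2 h
    have h2 := Nat.ceil_le_floor_add_one a
    unfold pieceIndex
    omega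

theorem even_pieceIndex_iff {a : ℝ} (ha : 0 ≤ a) : Even (pieceIndex a) ↔ ∃ m : ℕ, a = m := by
  constructor
  · intro h
    rcases eq_natFloor_or_pieceIndex_eq ha with h' | ⟨-, -, h'⟩
    · exact ⟨_, h'⟩
    · rw [h'] at h
      exact absurd h (by simp)
  · rintro ⟨m, rfl⟩
    simp [pieceIndex_natCast]

theorem pieceIndex_eq_of_mem_Ioo {a : ℝ} {k : ℕ} (h : a ∈ Ioo (k : ℝ) (k + 1)) :
    pieceIndex a = 2 * k + 1 := by
  have h0 : 0 ≤ a := (Nat.cast_nonneg k).trans h.1.le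
  have h1 : ⌊a⌋₊ = k := (Nat.floor_eq_iff h0).2 ⟨h.1.le, h.2⟩
  rcases eq_natFloor_or_pieceIndex_eq h0 with h' | ⟨-, -, h'⟩
  · rw [h1] at h'
    exact absurd h' h.1.ne'
  · rw [h', h1]

theorem eq_or_mem_Ioo_of_pieceIndex_eq {a b : ℝ} (ha : 0 ≤ a) (hb : 0 ≤ b)
    (h : pieceIndex a = pieceIndex b) :
    a = b ∨ ∃ k : ℕ, a ∈ Ioo (k : ℝ) (k + 1) ∧ b ∈ Ioo (k : ℝ) (k + 1) := by
  rcases eq_natFloor_or_pieceIndex_eq ha with h1 | ⟨h1, h1', h1''⟩ <;>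
    rcases eq_natFloor_or_pieceIndex_eq hb with h2 | ⟨h2, h2', h2''⟩
  · left
    rw [h1, h2, pieceIndex_natCast, pieceIndex_natCast] at h
    rw [h1, h2]
    exact_mod_cast (by omega : ⌊a⌋₊ = ⌊b⌋₊)
  · rw [h2'', h1, pieceIndex_natCast] at h
    omega
  · rw [h1'', h2, pieceIndex_natCast] at h
    omega
  · right
    have : ⌊a⌋₊ = ⌊b⌋₊ := by omega
    exact ⟨⌊a⌋₊, ⟨h1, h1'⟩, by rw [this]; exact ⟨h2, h2'⟩⟩

theorem pieceIndex_eq_of_forall_notMem_uIcc {a b : ℝ} (ha : 0 ≤ a) (hb : 0 ≤ b)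
    (h : ∀ m : ℕ, (m : ℝ) ∉ uIcc a b) : pieceIndex a = pieceIndex b := by
  wlog hab : a ≤ b generalizing a b
  · exact (this hb ha (by rwa [uIcc_comm]) (le_of_not_ge hab)).symm
  rw [uIcc_of_le hab] at h
  have h1 : ⌊b⌋₊ ≤ ⌊a⌋₊ := by
    by_contra! h'
    exact h _ ⟨((Nat.floor_lt ha).1 h').le, Nat.floor_le hb⟩
  have h2 : ⌈b⌉₊ ≤ ⌈a⌉₊ := by
    by_contra! h'
    exact h _ ⟨Nat.le_ceil a, (Nat.lt_ceil.1 h').le⟩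
  have h3 := Nat.floor_mono hab
  have h4 := Nat.ceil_mono hab
  unfold pieceIndex
  omega

variable {p : ℝ}

theorem AddCircle.exists_eq_or_eq_neg_norm [hp : Fact (0 < p)] (z : AddCircle p) :
    z = (‖z‖ : ℝ) ∨ z = -((‖z‖ : ℝ) : AddCircle p) := by
  obtain ⟨x, hx, rfl⟩ : ∃ x : ℝ, |x| ≤ |p| / 2 ∧ (x : AddCircle p) = z := by
    have hz := (AddCircle.equivIco p (-(p / 2)) z).2
    refine ⟨(AddCircle.equivIco p (-(p / 2)) z : ℝ), ?_, AddCircle.coe_equivIco⟩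
    rw [abs_of_pos hp.out, abs_le]
    exact ⟨hz.1, by linarith [hz.2]⟩
  rw [(AddCircle.norm_coe_eq_abs_iff p hp.out.ne').2 hx]
  rcases abs_choice x with h | h
  · exact Or.inl (by rw [h])
  · exact Or.inr (by rw [h, AddCircle.coe_neg, neg_neg])

theorem AddCircle.norm_coe_of_mem_Icc [hp : Fact (0 < p)] {x : ℝ} (hx : x ∈ Icc 0 (p / 2)) :
    ‖(x : AddCircle p)‖ = x := by
  rw [(AddCircle.norm_coe_eq_abs_iff p hp.out.ne').2, abs_of_nonneg hx.1]
  rw [abs_of_nonneg hx.1, abs_of_pos hp.out]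
  exact hx.2

/-- A translation shorter than the distance to the integer-norm points meets none of them on the
way, so by the intermediate value theorem the norm crosses no integer. -/
theorem AddCircle.pieceIndex_norm_add_coe {z : AddCircle p} {r : ℝ}
    (hr : |r| < infDist z {w : AddCircle p | ∃ m : ℕ, ‖w‖ = m}) :
    pieceIndex ‖z + (r : AddCircle p)‖ = pieceIndex ‖z‖ := by
  refine (pieceIndex_eq_of_forall_notMem_uIcc (norm_nonneg _) (norm_nonneg _) fun m hm => ?_).symm
  have hcont : ContinuousOn (fun t : ℝ => ‖z + (t : AddCircle p)‖) (uIcc 0 r) :=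
    (continuous_const.add (AddCircle.continuous_mk' p)).norm.continuousOn
  have := intermediate_value_uIcc hcont
  simp only [AddCircle.coe_zero, add_zero] at this
  obtain ⟨t, ht, htm⟩ := this hm
  have h1 : infDist z {w : AddCircle p | ∃ m : ℕ, ‖w‖ = m} ≤ dist z (z + (t : AddCircle p)) :=
    infDist_le_dist_of_mem ⟨m, htm⟩
  rw [dist_self_add_right] at h1
  have h2 : |t| ≤ |r| := by simpa using abs_sub_left_of_mem_uIcc ht
  linarith [AddCircle.norm_coe_le_abs (p := p) t]

theorem AddCircle.exists_homeomorph_of_lt_infDist [Fact (0 < p)] {z : AddCircle p} {r : ℝ}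
    (hr : |r| < infDist z {w : AddCircle p | ∃ m : ℕ, ‖w‖ = m}) :
    ∃ g : AddCircle p ≃ₜ AddCircle p, (∀ w, pieceIndex ‖g w‖ = pieceIndex ‖w‖) ∧ g z = z + r := by
  set F := {w : AddCircle p | ∃ m : ℕ, ‖w‖ = m}
  have hd : 0 < infDist z F := (abs_nonneg r).trans_lt hr
  have hc : |r / infDist z F| < 1 := by
    rwa [abs_div, abs_of_pos hd, div_lt_one hd]
  obtain ⟨g, hg⟩ := exists_homeomorph_add_infDist F hc
  refine ⟨g, fun w => ?_, by rw [hg, div_mul_cancel₀ _ hd.ne']⟩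
  rw [hg]
  rcases (infDist_nonneg (x := w) (s := F)).eq_or_lt with h | h
  · simp [← h]
  · refine pieceIndex_norm_add_coe ?_
    rw [abs_mul, abs_of_pos h]
    exact mul_lt_of_lt_one_left h hc

theorem isClosed_setOf_norm_eq_natCast {E : Type*} [SeminormedAddCommGroup E] :
    IsClosed {w : E | ∃ m : ℕ, ‖w‖ = m} := by
  have : {w : E | ∃ m : ℕ, ‖w‖ = m} = norm ⁻¹' range ((↑) : ℕ → ℝ) := by
    ext w
    simp [eq_comm]
  rw [this]
  exact Nat.isClosedEmbedding_coe_real.isClosed_range.preimage continuous_norm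

theorem AddCircle.exists_homeomorph_of_pieceIndex_eq [hp : Fact (0 < p)] {z w : AddCircle p}
    (h : pieceIndex ‖z‖ = pieceIndex ‖w‖) :
    ∃ g : AddCircle p ≃ₜ AddCircle p, (∀ u, pieceIndex ‖g u‖ = pieceIndex ‖u‖) ∧ g z = w := by
  let R : AddCircle p → AddCircle p → Prop := fun z w =>
    ∃ g : AddCircle p ≃ₜ AddCircle p, (∀ u, pieceIndex ‖g u‖ = pieceIndex ‖u‖) ∧ g z = w
  have hsymm : ∀ z w, R z w → R w z := by
    rintro z _ ⟨g, hg, rfl⟩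
    refine ⟨g.symm, fun u => ?_, g.symm_apply_apply z⟩
    rw [← hg, g.apply_symm_apply]
  have htrans : ∀ z w u, R z w → R w u → R z u := by
    rintro z _ _ ⟨g, hg, rfl⟩ ⟨g', hg', rfl⟩
    exact ⟨g.trans g', fun u => (hg' _).trans (hg u), rfl⟩
  have hneg : ∀ z, R z (-z) := fun z => ⟨Homeomorph.neg _, fun u => by simp, rfl⟩
  have hnorm : ∀ z, R z (‖z‖ : ℝ) := by
    intro z
    rcases exists_eq_or_eq_neg_norm z with hz | hz
    · rw [← hz]
      exact ⟨Homeomorph.refl _, fun _ => rfl, rfl⟩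
    · have := hneg z
      rwa [show -z = (‖z‖ : ℝ) by rw [neg_eq_iff_eq_neg]; exact hz] at this
  -- Negation preserves labels, so both points may be replaced by their norms.
  refine htrans _ _ _ (hnorm z) (htrans _ _ _ ?_ (hsymm _ _ (hnorm w)))
  have hle : ∀ z : AddCircle p, ‖z‖ ≤ p / 2 := fun z => by
    have := norm_le_half_period p hp.out.ne' (x := z)
    rwa [abs_of_pos hp.out] at this
  rcases eq_or_mem_Ioo_of_pieceIndex_eq (norm_nonneg z) (norm_nonneg w) h with heq | ⟨k, hz, hw⟩
  · rw [heq]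
    exact ⟨Homeomorph.refl _, fun _ => rfl, rfl⟩
  -- Small moves are available near each point; connectedness chains them. The cut at `p / 2` keeps
  -- the norm of the class of `s` equal to `s`.
  · have hconn : IsPreconnected (Ioo (k : ℝ) (k + 1) ∩ Set.Iic (p / 2)) :=
      ((convex_Ioo _ _).inter (convex_Iic _)).isPreconnected
    refine hconn.induction₂' (fun s t : ℝ => R s t) (fun s hs => ?_)
      (fun _ _ _ _ _ _ => htrans _ _ _) ⟨hz, hle z⟩ ⟨hw, hle w⟩
    set F := {w : AddCircle p | ∃ m : ℕ, ‖w‖ = m} with hF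
    have hsn : ‖(s : AddCircle p)‖ = s :=
      norm_coe_of_mem_Icc ⟨(Nat.cast_nonneg k).trans hs.1.1.le, hs.2⟩
    have hd : 0 < infDist (s : AddCircle p) F := by
      rw [← isClosed_setOf_norm_eq_natCast.notMem_iff_infDist_pos ⟨0, 0, by simp⟩]
      rintro ⟨m, hm⟩
      have h1 := (even_pieceIndex_iff (hsn ▸ norm_nonneg _)).2 ⟨m, hsn ▸ hm⟩
      rw [pieceIndex_eq_of_mem_Ioo hs.1] at h1
      exact absurd h1 (by simp)
    filter_upwards [mem_nhdsWithin_of_mem_nhds (ball_mem_nhds s hd)] with t ht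
    have hR : R s t := by
      have := exists_homeomorph_of_lt_infDist (z := (s : AddCircle p)) (r := t - s) ht
      rwa [← AddCircle.coe_add, add_sub_cancel] at this
    exact ⟨hR, hsymm _ _ hR⟩

theorem natCast_mem_possibleHeights_of_homeomorph_circle {X : Type*} [TopologicalSpace X]
    (e : X ≃ₜ Circle) (n : ℕ) : (n : ℕ∞) ∈ possibleHeights X := by
  rcases Nat.eq_zero_or_pos n with rfl | hn
  -- A circle of circumference `0` is not available; a constant label and rotations do instead.
  · refine coe_mem_possibleHeights_of_fibers (fun _ => 0) (fun _ => le_rfl) (fun x y _ => ?_)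
      (fun _ => univ) (fun i j h => absurd h (by omega)) (fun _ => isClosed_univ) ⟨e.symm 1, trivial⟩ rfl
    exact ⟨e.trans ((Homeomorph.mulRight ((e x)⁻¹ * e y)).trans e.symm), fun _ => rfl, by simp⟩
  have hp : Fact (0 < (n : ℝ)) := ⟨by exact_mod_cast hn⟩
  let e' : X ≃ₜ AddCircle (n : ℝ) := e.trans (AddCircle.homeomorphCircle hp.out.ne').symm
  have hle : ∀ z : AddCircle (n : ℝ), ‖z‖ ≤ n / 2 := fun z => by
    have := AddCircle.norm_le_half_period (n : ℝ) hp.out.ne' (x := z)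
    rwa [abs_of_pos hp.out] at this
  have hnorm : ∀ x, 0 ≤ x → x ≤ (n : ℝ) / 2 → ‖e' (e'.symm (x : ℝ))‖ = x := fun x h1 h2 => by
    rw [e'.apply_symm_apply, AddCircle.norm_coe_of_mem_Icc ⟨h1, h2⟩]
  -- Even labels are single points, odd ones open pieces. Up to `k = n / 2` the truncated
  -- subtraction is `0` and only points are added; from then on each step adds one open piece.
  let S : ℕ → Set ℕ := fun k => {j | (Even j ∧ j ≤ 2 * k) ∨ j ≤ 2 * (k - n / 2)}
  have hS : ∀ k, (fun x => pieceIndex ‖e' x‖) ⁻¹' S k =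
      e' ⁻¹' ({w | ∃ m : ℕ, ‖w‖ = m} ∩ {w | ‖w‖ ≤ k} ∪ {w | ‖w‖ ≤ (k - n / 2 : ℕ)}) := by
    intro k
    ext x
    simp [S, even_pieceIndex_iff, pieceIndex_le_two_mul_iff]
  have hnn : n / 2 ≤ n := Nat.div_le_self n 2
  refine coe_mem_possibleHeights_of_fibers (fun x => pieceIndex ‖e' x‖) (fun x => ?_)
    (fun x y hxy => ?_) (fun k => S k) ?_ (fun k => ?_) ?_ ?_
  · have h1 : pieceIndex ‖e' x‖ ≤ pieceIndex (n / 2) :=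
      add_le_add (Nat.floor_mono (hle _)) (Nat.ceil_mono (hle _))
    refine h1.trans ?_
    rcases Nat.even_or_odd' n with ⟨m, rfl | rfl⟩
    · rw [show ((2 * m : ℕ) : ℝ) / 2 = m by push_cast; ring, pieceIndex_natCast]
    · rw [pieceIndex_eq_of_mem_Ioo (k := m)]
      push_cast
      constructor <;> linarith
  · obtain ⟨g, hg, hgx⟩ := AddCircle.exists_homeomorph_of_pieceIndex_eq hxy
    refine ⟨e'.trans (g.trans e'.symm), fun z => ?_, ?_⟩
    · simp [hg]
    · simp [hgx]
  · rw [Fin.strictMono_iff_lt_succ]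
    intro i
    simp only [Fin.val_castSucc, Fin.val_succ]
    have hi := i.2
    refine ⟨preimage_mono fun j hj => ?_, fun hsub => ?_⟩
    · simp only [S, mem_ofPred_eq] at hj ⊢
      exact hj.imp (fun h => ⟨h.1, by omega⟩) (fun h => by omega)
    rcases Nat.lt_or_ge i (n / 2) with h | h
    · have h1 : ‖e' (e'.symm ((i + 1 : ℕ) : ℝ))‖ = (i + 1 : ℕ) := by
        refine hnorm _ (Nat.cast_nonneg _) ?_
        rw [le_div_iff₀ two_pos]
        exact_mod_cast (by omega : (i + 1) * 2 ≤ n)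
      have h2 : e'.symm ((i + 1 : ℕ) : ℝ) ∈ (fun x => pieceIndex ‖e' x‖) ⁻¹' S i := by
        refine hsub ?_
        simp only [mem_preimage, h1, pieceIndex_natCast]
        exact Or.inl ⟨by simp, le_rfl⟩
      simp only [mem_preimage, h1, pieceIndex_natCast, S, mem_ofPred_eq] at h2
      omega
    -- The midpoint `j + 1 / 2` lies in the new piece. For odd `n` the last piece is cut off at `n /
    -- 2`, which is exactly this value.
    · set j := (i : ℕ) - n / 2 with hj
      have h1 : ‖e' (e'.symm ((j + 1 / 2 : ℝ)))‖ = j + 1 / 2 := by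
        refine hnorm _ (by positivity) ?_
        have : (2 * j + 1 : ℝ) ≤ n := by exact_mod_cast (by omega : 2 * j + 1 ≤ n)
        linarith
      have h3 : pieceIndex ((j : ℝ) + 1 / 2) = 2 * j + 1 :=
        pieceIndex_eq_of_mem_Ioo ⟨by linarith, by linarith⟩
      have h2 : e'.symm ((j + 1 / 2 : ℝ)) ∈ (fun x => pieceIndex ‖e' x‖) ⁻¹' S i := by
        refine hsub ?_
        simp only [mem_preimage, h1, h3]
        exact Or.inr (by omega)
      simp only [mem_preimage, h1, h3, S, mem_ofPred_eq] at h2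
      rcases h2 with h2 | h2
      · exact absurd h2.1 (by simp)
      · omega
  · rw [hS]
    exact ((isClosed_setOf_norm_eq_natCast.inter (isClosed_le continuous_norm continuous_const)).union
      (isClosed_le continuous_norm continuous_const)).preimage e'.continuous
  · rw [hS]
    exact ⟨e'.symm 0, Or.inl ⟨⟨0, by simp⟩, by simp⟩⟩
  · rw [hS]
    refine eq_univ_of_forall fun x => Or.inr ?_
    refine (hle _).trans ?_
    rw [div_le_iff₀ two_pos]
    exact_mod_cast (by simp only [Fin.val_last]; omega : n ≤ (((Fin.last n : Fin (n + 1)) : ℕ) - n / 2) * 2)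

end CircleLabel

/-! ### The order of a point, a topological invariant -/

section PointOrder

variable {X : Type*} [TopologicalSpace X]

/-- The point `x` has arbitrarily small open neighbourhoods with at most `m` boundary points. -/
def PointOrderLE (m : ℕ∞) (x : X) : Prop :=
  ∀ U ∈ 𝓝 x, ∃ V, IsOpen V ∧ x ∈ V ∧ V ⊆ U ∧ (frontier V).encard ≤ m

theorem PointOrderLE.homeomorph {m : ℕ∞} {x : X} (h : PointOrderLE m x) (g : X ≃ₜ X) :
    PointOrderLE m (g x) := by
  intro U hU
  obtain ⟨V, hV, hxV, hVU, hm⟩ := h (g ⁻¹' U) (g.continuous.continuousAt hU)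
  refine ⟨g '' V, g.isOpenMap V hV, mem_image_of_mem g hxV, image_subset_iff.2 hVU, ?_⟩
  rwa [← g.image_frontier, g.injective.encard_image]

theorem pointOrderLE_homeomorph_iff {m : ℕ∞} {x : X} (g : X ≃ₜ X) :
    PointOrderLE m (g x) ↔ PointOrderLE m x :=
  ⟨fun h => by simpa using h.homeomorph g.symm, fun h => h.homeomorph g⟩

/-- If `κ`-many connected sets pairwise meet only in `v`, then the boundary of every small
neighbourhood of `v` meets each of them. -/
theorem PointOrderLE.card_le [T1Space X] {m : ℕ∞} {v : X} (h : PointOrderLE m v) {κ : Type*}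
    [Finite κ] (K : κ → Set X) (hK : ∀ k, IsPreconnected (K k)) (hv : ∀ k, v ∈ K k)
    (hne : ∀ k, ∃ y ∈ K k, y ≠ v) (hdisj : ∀ k l, k ≠ l → K k ∩ K l ⊆ {v}) :
    ENat.card κ ≤ m := by
  choose y hyK hyv using hne
  have hU : (range y)ᶜ ∈ 𝓝 v :=
    (finite_range y).isClosed.isOpen_compl.mem_nhds (by rintro ⟨k, hk⟩; exact hyv k hk)
  obtain ⟨V, hV, hvV, hVU, hm⟩ := h _ hU
  -- Each `K k` contains `v` inside `V` and `y k` outside, so connectedness forces it across the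
  -- boundary. These crossing points differ, since a shared one would be `v`.
  have hfr : ∀ k, ∃ c ∈ K k, c ∈ frontier V := by
    intro k
    have hyV : y k ∉ V := fun hy => hVU hy (mem_range_self k)
    by_contra! hno
    have hsub : K k ⊆ V ∪ (closure V)ᶜ := by
      intro c hc
      by_cases hcV : c ∈ V
      · exact Or.inl hcV
      · exact Or.inr fun hcl => hno c hc ⟨hcl, by rwa [hV.interior_eq]⟩
    obtain ⟨c, -, hcV, hcV'⟩ := hK k V (closure V)ᶜ hV isClosed_closure.isOpen_compl hsub
      ⟨v, hv k, hvV⟩ ⟨y k, hyK k, (hsub (hyK k)).resolve_left hyV⟩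
    exact hcV' (subset_closure hcV)
  choose c hcK hcV using hfr
  have hinj : Function.Injective c := by
    intro k l hkl
    by_contra hne
    have : c k = v := hdisj k l hne ⟨hcK k, hkl ▸ hcK l⟩
    exact (hcV k).2 (by rwa [this, hV.interior_eq])
  calc ENat.card κ = (range c).encard := by
        rw [← image_univ, hinj.encard_image, encard_univ]
    _ ≤ (frontier V).encard := encard_le_encard (range_subset_iff.2 hcV)
    _ ≤ m := hm

/-- Neighbourhoods mapped into the interior of the range have open images, and closedness of `f`
carries boundaries to boundaries. -/
theorem Topology.IsClosedEmbedding.pointOrderLE {Z : Type*} [TopologicalSpace Z] {f : Z → X}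
    (hf : IsClosedEmbedding f) {m : ℕ∞} {z : Z} (hz : PointOrderLE m z)
    (hint : range f ∈ 𝓝 (f z)) : PointOrderLE m (f z) := by
  intro U hU
  obtain ⟨V, hV, hzV, hVU, hm⟩ := hz (f ⁻¹' (U ∩ interior (range f)))
    (hf.continuous.continuousAt (inter_mem hU (interior_mem_nhds.2 hint)))
  have hopen : IsOpen (f '' V) := by
    obtain ⟨W, hW, rfl⟩ := hf.isInducing.isOpen_iff.1 hV
    have : f '' (f ⁻¹' W) = W ∩ interior (range f) := by
      rw [image_preimage_eq_inter_range]
      refine subset_antisymm ?_ (inter_subset_inter_right _ interior_subset)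
      rintro _ ⟨hw, t, rfl⟩
      exact ⟨hw, (hVU hw).2⟩
    rw [this]
    exact hW.inter isOpen_interior
  refine ⟨f '' V, hopen, mem_image_of_mem f hzV, ?_, ?_⟩
  · exact (image_subset_iff.2 hVU).trans inter_subset_left
  · rw [hopen.frontier_eq, hf.closure_image_eq, ← image_sdiff hf.injective, ← hV.frontier_eq,
      hf.injective.encard_image]
    exact hm

open Metric in
theorem pointOrderLE_of_sphere {Z : Type*} [PseudoMetricSpace Z] {m : ℕ∞} {z : Z}
    (h : ∀ ε, 0 < ε → (sphere z ε).encard ≤ m) : PointOrderLE m z := by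
  intro U hU
  obtain ⟨ε, hε, hsub⟩ := Metric.mem_nhds_iff.1 hU
  exact ⟨ball z ε, isOpen_ball, mem_ball_self hε, hsub,
    (encard_le_encard frontier_ball_subset_sphere).trans (h ε hε)⟩

theorem unitInterval.pointOrderLE_two (t : unitInterval) : PointOrderLE 2 t := by
  refine pointOrderLE_of_sphere fun ε _ => ?_
  rw [← Subtype.val_injective.encard_image]
  refine (encard_le_encard (t := {(t : ℝ) + ε, (t : ℝ) - ε}) ?_).trans ?_
  swap
  · exact (encard_insert_le _ _).trans (by rw [encard_singleton]; norm_num)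
  rintro _ ⟨s, hs, rfl⟩
  have hs' : |(s : ℝ) - t| = ε := hs
  rcases abs_choice ((s : ℝ) - t) with h | h
  · exact Or.inl (by linarith)
  · exact Or.inr (by rw [mem_singleton_iff]; linarith)

theorem unitInterval.pointOrderLE_one {t : unitInterval} (ht : t = 0 ∨ t = 1) :
    PointOrderLE 1 t := by
  refine pointOrderLE_of_sphere fun ε _ => ?_
  rw [encard_le_one_iff]
  intro a b ha hb
  have ha' : |(a : ℝ) - t| = ε := ha
  have hb' : |(b : ℝ) - t| = ε := hb
  have := a.2.1
  have := b.2.1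
  have := a.2.2
  have := b.2.2
  apply Subtype.ext
  rcases ht with rfl | rfl
  · simp only [Icc.coe_zero, sub_zero] at ha' hb'
    rw [abs_of_nonneg ‹_›] at ha' hb'
    linarith
  · simp only [Icc.coe_one] at ha' hb'
    rw [abs_of_nonpos (by linarith)] at ha' hb'
    linarith

/-- Otherwise `S ⊂ X` is a chain of length `1` for every group of homeomorphisms. -/
theorem eq_empty_of_zero_mem_possibleHeights [T1Space X] [Infinite X]
    (h0 : (0 : ℕ∞) ∈ possibleHeights X) {S : Set X} (hS : S.Finite)
    (hinv : ∀ g : X ≃ₜ X, ∀ x ∈ S, g x ∈ S) : S = ∅ := by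
  obtain ⟨G, hG⟩ := h0
  by_contra hne
  have h1 : ((1 : ℕ) : ℕ∞) ≤ transformationHeight G X := by
    refine le_sSup ⟨1, rfl, ![S, univ], ?_, ?_, rfl⟩
    · rw [Fin.strictMono_iff_lt_succ]
      intro i
      fin_cases i
      exact ssubset_univ_iff.2 fun h : S = univ => infinite_univ (h ▸ hS)
    · intro k
      fin_cases k
      · exact ⟨nonempty_iff_ne_empty.2 hne, hS.isClosed, fun g y hy => hinv g.1 y hy⟩
      · exact ⟨univ_nonempty, isClosed_univ, fun _ _ _ => mem_univ _⟩
  rw [← hG] at h1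
  simp at h1

end PointOrder

/-! ### Degree versus order; height zero forces degree two -/

namespace ArcDecomposition

variable {ι X : Type*} [TopologicalSpace X] (Γ : ArcDecomposition ι X)

/-- The set of end points of an arc. -/
def ends (i : ι) : Set X := {Γ.arc i 0, Γ.arc i 1}

variable {Γ}

theorem mem_vertices_iff {v : X} : v ∈ Γ.vertices ↔ ∃ i, v ∈ Γ.ends i := Iff.rfl

theorem degree_eq (v : X) : Γ.degree v = {i | v ∈ Γ.ends i}.ncard := rfl

theorem arc_injective (i : ι) : Function.Injective (Γ.arc i) := (Γ.isEmbedding_arc i).injective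

theorem ends_subset_range (i : ι) : Γ.ends i ⊆ range (Γ.arc i) := by
  rintro _ (rfl | rfl) <;> exact mem_range_self _

theorem mem_ends_of_mem_range {i j : ι} (hij : i ≠ j) {x : X} (hi : x ∈ range (Γ.arc i))
    (hj : x ∈ range (Γ.arc j)) : x ∈ Γ.ends i ∧ x ∈ Γ.ends j :=
  Γ.inter_subset_ends i j hij ⟨hi, hj⟩

theorem exists_mem_range (x : X) : ∃ i, x ∈ range (Γ.arc i) := by
  have := mem_univ x
  rw [← Γ.iUnion_range_arc] at this
  exact mem_iUnion.1 this

theorem arc_mem_ends_iff {i : ι} {t : unitInterval} : Γ.arc i t ∈ Γ.ends i ↔ t = 0 ∨ t = 1 := by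
  simp [ends, (arc_injective i).eq_iff]

theorem finite_vertices [Finite ι] (Γ : ArcDecomposition ι X) : Γ.vertices.Finite := by
  have : Γ.vertices = ⋃ i, Γ.ends i := by
    ext v
    simp [mem_vertices_iff]
  rw [this]
  exact finite_iUnion fun i => (finite_singleton _).insert _

theorem notMem_range_of_ends_subset {i : ι} {x : X} (hi : x ∈ range (Γ.arc i))
    (h : ∀ j, x ∈ Γ.ends j → j = i) (j : ι) (hj : j ≠ i) : x ∉ range (Γ.arc j) := fun hx =>
  hj (h j (mem_ends_of_mem_range hj hx hi).1)

variable [T2Space X]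

theorem isClosedEmbedding_arc (i : ι) : IsClosedEmbedding (Γ.arc i) :=
  (Γ.isEmbedding_arc i).continuous.isClosedEmbedding (arc_injective i)

/-- A point that is an end point of no arc other than `A_i` is interior to `A_i`. -/
theorem range_mem_nhds [Finite ι] {i : ι} {x : X} (hx : ∀ j, j ≠ i → x ∉ range (Γ.arc j)) :
    range (Γ.arc i) ∈ 𝓝 x := by
  have hcl : IsClosed (⋃ j : {j // j ≠ i}, range (Γ.arc j)) :=
    isClosed_iUnion_of_finite fun j => (isClosedEmbedding_arc j.1).isClosed_range
  refine mem_of_superset (hcl.isOpen_compl.mem_nhds ?_) ?_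
  · simpa using hx
  · intro y hy
    obtain ⟨j, hj⟩ := Γ.exists_mem_range y
    by_cases hji : j = i
    · rwa [hji] at hj
    · exact absurd (mem_iUnion.2 ⟨⟨j, hji⟩, hj⟩) hy

theorem pointOrderLE_two_of_notMem_vertices [Finite ι] {x : X} (hx : x ∉ Γ.vertices) :
    PointOrderLE 2 x := by
  obtain ⟨i, hi⟩ := Γ.exists_mem_range x
  have hint := range_mem_nhds (notMem_range_of_ends_subset hi fun j hj => absurd ⟨j, hj⟩ hx)
  obtain ⟨t, rfl⟩ := hi
  exact (isClosedEmbedding_arc i).pointOrderLE (unitInterval.pointOrderLE_two t) hint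

theorem pointOrderLE_one_of_degree_eq_one [Finite ι] {v : X} (hv : Γ.degree v = 1) :
    PointOrderLE 1 v := by
  rw [degree_eq, ncard_eq_one] at hv
  obtain ⟨i, hi⟩ := hv
  have hvi : v ∈ Γ.ends i := by
    change i ∈ {i | v ∈ Γ.ends i}
    rw [hi]
    rfl
  have hint := range_mem_nhds (notMem_range_of_ends_subset (ends_subset_range i hvi)
    fun j hj => hi.subset hj)
  obtain ⟨t, rfl⟩ := ends_subset_range i hvi
  exact (isClosedEmbedding_arc i).pointOrderLE
    (unitInterval.pointOrderLE_one (arc_mem_ends_iff.1 hvi)) hint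

theorem not_pointOrderLE_one_of_notMem_vertices {x : X} (hx : x ∉ Γ.vertices) :
    ¬ PointOrderLE 1 x := by
  obtain ⟨i, t, rfl⟩ := Γ.exists_mem_range x
  intro h
  have ht : t ≠ 0 ∧ t ≠ 1 := by
    rw [← not_or, ← arc_mem_ends_iff (Γ := Γ) (i := i)]
    exact fun h => hx ⟨i, h⟩
  have hcont := (Γ.isEmbedding_arc i).continuous
  -- The two sides of the arc meet only in the given point, so its order is at least `2`.
  have := h.card_le (fun b : Bool => Γ.arc i '' (if b then Set.Iic t else Set.Ici t)) ?_ ?_ ?_ ?_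
  · simp at this
  · intro b
    refine IsPreconnected.image ?_ _ hcont.continuousOn
    cases b
    · exact isPreconnected_Ici
    · exact isPreconnected_Iic
  · intro b
    refine mem_image_of_mem _ ?_
    cases b <;> simp
  · intro b
    cases b
    · exact ⟨_, ⟨1, unitInterval.le_one', rfl⟩, fun h => ht.2 (arc_injective i h).symm⟩
    · exact ⟨_, ⟨0, unitInterval.nonneg', rfl⟩, fun h => ht.1 (arc_injective i h).symm⟩
  · intro k l hkl
    rw [← image_inter (arc_injective i)]
    rintro _ ⟨s, hs, rfl⟩
    refine congrArg _ ?_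
    cases k <;> cases l
    · exact absurd rfl hkl
    · exact le_antisymm hs.2 hs.1
    · exact le_antisymm hs.1 hs.2
    · exact absurd rfl hkl

theorem degree_le_of_pointOrderLE [Finite ι] {m : ℕ} {v : X} (h : PointOrderLE (m : ℕ∞) v) :
    Γ.degree v ≤ m := by
  have hhalf : ∃ c : unitInterval, 0 < c ∧ c < 1 := exists_between zero_lt_one
  obtain ⟨c, hc0, hc1⟩ := hhalf
  -- Only the part of each arc from `v` to `c` is used: two arcs may share their other end as well,
  -- and the cut parts then still meet only in `v`.
  have key : ∀ k : {i | v ∈ Γ.ends i}, ∃ T : Set unitInterval, IsPreconnected T ∧ c ∈ T ∧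
      v ∈ Γ.arc k '' T ∧ ∀ t ∈ T, Γ.arc k t ∈ Γ.ends k → Γ.arc k t = v := by
    rintro ⟨k, hk⟩
    rcases hk with hk | hk
    · refine ⟨Set.Iic c, isPreconnected_Iic, Set.mem_Iic.2 le_rfl, ⟨0, hc0.le, hk.symm⟩, fun t ht hte => ?_⟩
      rcases arc_mem_ends_iff.1 hte with rfl | rfl
      · exact hk.symm
      · exact absurd hc1 (not_lt.2 ht)
    · refine ⟨Set.Ici c, isPreconnected_Ici, Set.mem_Ici.2 le_rfl, ⟨1, hc1.le, hk.symm⟩, fun t ht hte => ?_⟩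
      rcases arc_mem_ends_iff.1 hte with rfl | rfl
      · exact absurd hc0 (not_lt.2 ht)
      · exact hk.symm
  choose T hT hcT hvT hTe using key
  have := h.card_le (fun k : {i | v ∈ Γ.ends i} => Γ.arc k '' T k)
    (fun k => (hT k).image _ (Γ.isEmbedding_arc k).continuous.continuousOn) hvT ?_ ?_
  · rw [degree_eq, ← Nat.card_coe_set_eq]
    rw [ENat.card_eq_coe_natCard] at this
    exact_mod_cast this
  · intro k
    refine ⟨_, mem_image_of_mem _ (hcT k), fun h => ?_⟩
    have hk : Γ.arc k c ∈ Γ.ends k := h.symm ▸ (k.2 : v ∈ Γ.ends k)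
    exact (arc_mem_ends_iff.1 hk).elim hc0.ne' hc1.ne
  · rintro k l hkl _ ⟨⟨t, ht, rfl⟩, s, hs, hst⟩
    exact hTe k t ht (mem_ends_of_mem_range (fun h => hkl (Subtype.ext h)) ⟨t, rfl⟩ ⟨s, hst⟩).1

theorem degree_eq_two_of_zero_mem_possibleHeights [Finite ι] [Infinite X]
    (h0 : (0 : ℕ∞) ∈ possibleHeights X) {v : X} (hv : v ∈ Γ.vertices) : Γ.degree v = 2 := by
  have h2 : {x : X | ¬ PointOrderLE 2 x} = ∅ := by
    refine eq_empty_of_zero_mem_possibleHeights h0 (Γ.finite_vertices.subset fun x hx => ?_)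
      fun g x hx h => hx ((pointOrderLE_homeomorph_iff g).1 h)
    by_contra hxv
    exact hx (pointOrderLE_two_of_notMem_vertices hxv)
  have h1 : {x : X | PointOrderLE 1 x} = ∅ := by
    refine eq_empty_of_zero_mem_possibleHeights h0 (Γ.finite_vertices.subset fun x hx => ?_)
      fun g x hx => (pointOrderLE_homeomorph_iff g).2 hx
    by_contra hxv
    exact not_pointOrderLE_one_of_notMem_vertices hxv hx
  have hle : Γ.degree v ≤ 2 := by
    refine degree_le_of_pointOrderLE ?_
    by_contra h
    exact h2.subset h
  have hne : Γ.degree v ≠ 1 := fun h => h1.subset (pointOrderLE_one_of_degree_eq_one h)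
  have hpos : 0 < Γ.degree v := by
    rw [degree_eq, ncard_pos]
    exact hv
  omega

end ArcDecomposition

/-! ### Concatenating injective paths to an arc or a circle -/

section Path

variable {X : Type*} [TopologicalSpace X] {u v w : X}

/-- Allowing the second coincidence `p 0 = q 1` lets this serve both the open case, an arc, and the
closed case, a circle. -/
theorem Path.eq_zero_and_eq_one_of_trans_eq {p : Path u v} {q : Path v w}
    (hp : Function.Injective p) (hq : Function.Injective q)
    (h : ∀ a b, p a = q b → (a = 1 ∧ b = 0) ∨ (a = 0 ∧ b = 1)) {s t : unitInterval} (hst : s < t)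
    (heq : p.trans q s = p.trans q t) : s = 0 ∧ t = 1 := by
  have hst' : (s : ℝ) < t := hst
  rw [Path.trans_apply, Path.trans_apply] at heq
  split_ifs at heq with h1 h2 h2
  · have := congrArg Subtype.val (hp heq)
    simp only at this
    linarith
  · rcases h _ _ heq with ⟨ha, hb⟩ | ⟨ha, hb⟩ <;> have ha' := congrArg Subtype.val ha <;>
      have hb' := congrArg Subtype.val hb <;> simp only [Icc.coe_zero, Icc.coe_one] at ha' hb'
    · linarith
    · constructor <;> apply Subtype.ext <;> simp only [Icc.coe_zero, Icc.coe_one] <;> linarith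
  · linarith
  · have := congrArg Subtype.val (hq heq)
    simp only at this
    linarith

theorem Path.injective_trans {p : Path u v} {q : Path v w} (hp : Function.Injective p)
    (hq : Function.Injective q) (h : range p ∩ range q ⊆ {v}) (huw : u ≠ w) :
    Function.Injective (p.trans q) := by
  have key : ∀ s t : unitInterval, s < t → p.trans q s ≠ p.trans q t := by
    intro s t hst heq
    have hends : ∀ a b, p a = q b → (a = 1 ∧ b = 0) ∨ (a = 0 ∧ b = 1) := by
      intro a b hab
      have hv : p a = v := h ⟨mem_range_self a, hab ▸ mem_range_self b⟩
      exact Or.inl ⟨hp (hv.trans p.target.symm), hq (by rw [← hab, hv, q.source])⟩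
    obtain ⟨rfl, rfl⟩ := eq_zero_and_eq_one_of_trans_eq hp hq hends hst heq
    rw [Path.source, Path.target] at heq
    exact huw heq
  intro s t heq
  by_contra hne
  rcases lt_or_gt_of_ne hne with h | h
  · exact key s t h heq
  · exact key t s h heq.symm

theorem Path.nonempty_homeomorph_circle [T2Space X] (γ : Path u u) (hsurj : Function.Surjective γ)
    (hinj : ∀ s t, s < t → γ s = γ t → s = 0 ∧ t = 1) : Nonempty (X ≃ₜ Circle) := by
  have hinj' : ∀ s t, s < 1 → t < 1 → γ s = γ t → s = t := by
    intro s t hs ht h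
    by_contra hne
    rcases lt_or_gt_of_ne hne with hlt | hlt
    · exact ht.ne (hinj s t hlt h).2
    · exact hs.ne (hinj t s hlt h.symm).2
  have hp : Fact ((0 : ℝ) < 1) := ⟨one_pos⟩
  let f : AddCircle (1 : ℝ) → X := AddCircle.liftIco 1 0 γ.extend
  have hcoe : ∀ t : unitInterval, t < 1 → f ((t : ℝ) : AddCircle (1 : ℝ)) = γ t := by
    intro t ht
    have ht' : (t : ℝ) < 1 := ht
    rw [show f _ = _ from AddCircle.liftIco_zero_coe_apply ⟨t.2.1, ht'⟩, γ.extend_apply t.2]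
  have hex : ∀ z : AddCircle (1 : ℝ), ∃ t : unitInterval, t < 1 ∧
      z = ((t : ℝ) : AddCircle (1 : ℝ)) := by
    intro z
    have hz := (AddCircle.equivIco (1 : ℝ) 0 z).2
    have hz1 := hz.2.trans_eq (zero_add 1)
    exact ⟨⟨_, hz.1, hz1.le⟩, hz1, AddCircle.coe_equivIco.symm⟩
  have hcont : Continuous f :=
    AddCircle.liftIco_zero_continuous (by simp) γ.continuous_extend.continuousOn
  have hbij : Function.Bijective f := by
    constructor
    · intro z z' h
      obtain ⟨s, hs, rfl⟩ := hex z
      obtain ⟨t, ht, rfl⟩ := hex z'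
      rw [hcoe s hs, hcoe t ht] at h
      rw [hinj' s t hs ht h]
    · intro x
      obtain ⟨t, rfl⟩ := hsurj x
      rcases (unitInterval.le_one' (t := t)).lt_or_eq with h | rfl
      · exact ⟨_, hcoe t h⟩
      · exact ⟨_, (hcoe 0 zero_lt_one).trans (by simp)⟩
  exact ⟨(hcont.homeoOfEquivCompactToT2 (f := Equiv.ofBijective f hbij)).symm.trans
    (AddCircle.homeomorphCircle one_ne_zero)⟩

end Path

/-! ### Merging arcs when all degrees are two -/

namespace ArcDecomposition

variable {ι X : Type*} [TopologicalSpace X] {Γ : ArcDecomposition ι X}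

theorem exists_path_of_mem_ends {i : ι} {v : X} (hv : v ∈ Γ.ends i) :
    ∃ u, u ≠ v ∧ Γ.ends i = {u, v} ∧
      ∃ p : Path u v, Function.Injective p ∧ range p = range (Γ.arc i) := by
  let p : Path (Γ.arc i 0) (Γ.arc i 1) := ⟨⟨Γ.arc i, (Γ.isEmbedding_arc i).continuous⟩, rfl, rfl⟩
  have hne : Γ.arc i 0 ≠ Γ.arc i 1 := fun h => zero_ne_one (arc_injective i h)
  rcases hv with rfl | rfl
  · refine ⟨_, hne.symm, pair_comm _ _, p.symm, ?_, p.symm_range⟩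
    exact (arc_injective i).comp unitInterval.symm_bijective.injective
  · exact ⟨_, hne, rfl, p, arc_injective i, rfl⟩

/-- Every end point of an arc is an end point of exactly one other arc. -/
def EndsPaired (Γ : ArcDecomposition ι X) : Prop :=
  ∀ i, ∀ v ∈ Γ.ends i, ∃ j, j ≠ i ∧ v ∈ Γ.ends j ∧ ∀ k, v ∈ Γ.ends k → k = i ∨ k = j

theorem endsPaired_of_degree_eq_two (h : ∀ v ∈ Γ.vertices, Γ.degree v = 2) : Γ.EndsPaired := by
  intro i v hv
  obtain ⟨a, b, hab, hS⟩ := ncard_eq_two.1 (h v ⟨i, hv⟩)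
  have hmem : ∀ k, v ∈ Γ.ends k ↔ k = a ∨ k = b := fun k => Set.ext_iff.1 hS k
  rcases (hmem i).1 hv with rfl | rfl
  · exact ⟨b, hab.symm, (hmem b).2 (Or.inr rfl), fun k => (hmem k).1⟩
  · exact ⟨a, hab, (hmem a).2 (Or.inl rfl), fun k hk => ((hmem k).1 hk).symm⟩

theorem EndsPaired.eq_or_eq (h : Γ.EndsPaired) {i j k : ι} {v : X} (hij : i ≠ j)
    (hi : v ∈ Γ.ends i) (hj : v ∈ Γ.ends j) (hk : v ∈ Γ.ends k) : k = i ∨ k = j := by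
  obtain ⟨j', -, -, hu⟩ := h i v hi
  rcases hu j hj with h | rfl
  · exact absurd h hij.symm
  · exact hu k hk

open Classical in
/-- Replacing `A_i` and `A_j` by an arc `h` with range `A_i ∪ A_j`. -/
noncomputable def merge (Γ : ArcDecomposition ι X) {i j : ι} (hij : i ≠ j)
    (h : unitInterval → X) (hemb : IsEmbedding h)
    (hrange : range h = range (Γ.arc i) ∪ range (Γ.arc j))
    (hends : ∀ l, l ≠ i → l ≠ j →
      (Γ.ends i ∪ Γ.ends j) ∩ Γ.ends l ⊆ {h 0, h 1}) :
    ArcDecomposition {k // k ≠ j} X where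
  arc k := if k.1 = i then h else Γ.arc k
  isEmbedding_arc k := by
    split_ifs
    exacts [hemb, Γ.isEmbedding_arc k]
  iUnion_range_arc := by
    refine eq_univ_of_forall fun x => mem_iUnion.2 ?_
    obtain ⟨k, hk⟩ := Γ.exists_mem_range x
    by_cases hki : k = i ∨ k = j
    · refine ⟨⟨i, hij⟩, ?_⟩
      rw [if_pos rfl, hrange]
      rcases hki with rfl | rfl
      exacts [Or.inl hk, Or.inr hk]
    · rw [not_or] at hki
      refine ⟨⟨k, hki.2⟩, ?_⟩
      rwa [if_neg hki.1]
  inter_subset_ends := by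
    have key : ∀ l, l ≠ i → l ≠ j → range h ∩ range (Γ.arc l) ⊆ {h 0, h 1} ∩ Γ.ends l := by
      rintro l hli hlj x ⟨hx, hxl⟩
      rw [hrange] at hx
      rcases hx with hx | hx
      · have := mem_ends_of_mem_range hli.symm hx hxl
        exact ⟨hends l hli hlj ⟨Or.inl this.1, this.2⟩, this.2⟩
      · have := mem_ends_of_mem_range hlj.symm hx hxl
        exact ⟨hends l hli hlj ⟨Or.inr this.1, this.2⟩, this.2⟩
    rintro ⟨k, hk⟩ ⟨l, hl⟩ hkl
    replace hkl : k ≠ l := fun h => hkl (Subtype.ext h)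
    dsimp only
    split_ifs with h1 h2 h2
    · exact absurd (h1.trans h2.symm) hkl
    · exact key l h2 hl
    · rw [inter_comm, inter_comm {Γ.arc k 0, _}]
      exact key k h1 hk
    · exact Γ.inter_subset_ends k l hkl

/-- If all end points are paired, then two arcs with a common end point either have a union
homeomorphic to the circle, which is everything, or they can be merged into one arc. -/
theorem EndsPaired.nonempty_homeomorph_circle_or_exists [Finite ι] [T2Space X] [ConnectedSpace X]
    (hΓ : Γ.EndsPaired) (i : ι) :
    Nonempty (X ≃ₜ Circle) ∨
      ∃ (j : ι) (Γ' : ArcDecomposition {k // k ≠ j} X), Γ'.EndsPaired := by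
  have hv1 : Γ.arc i 1 ∈ Γ.ends i := Or.inr rfl
  set v := Γ.arc i 1
  obtain ⟨j, hji, hvj, -⟩ := hΓ i v hv1
  obtain ⟨a, hav, hai, p, hp, hpr⟩ := exists_path_of_mem_ends hv1
  obtain ⟨w, hwv, hwj, q', hq', hqr'⟩ := exists_path_of_mem_ends hvj
  obtain ⟨q, hq, hqr⟩ : ∃ q : Path v w, Function.Injective q ∧ range q = range (Γ.arc j) :=
    ⟨q'.symm, hq'.comp unitInterval.symm_bijective.injective, q'.symm_range.trans hqr'⟩
  have hpq : ∀ x, x ∈ range p → x ∈ range q → x ∈ ({a, v} : Set X) ∧ x ∈ ({w, v} : Set X) := by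
    intro x hx hx'
    rw [hpr] at hx
    rw [hqr] at hx'
    rw [← hai, ← hwj]
    exact mem_ends_of_mem_range hji.symm hx hx'
  have hvk : ∀ k, k ≠ i → k ≠ j → v ∉ Γ.ends k := fun k hki hkj hvk =>
    (hΓ.eq_or_eq hji.symm hv1 hvj hvk).elim hki hkj
  have haei : a ∈ Γ.ends i := by rw [hai]; exact Or.inl rfl
  have hwej : w ∈ Γ.ends j := by rw [hwj]; exact Or.inl rfl
  by_cases haw : a = w
  · left
    subst haw
    have hak : ∀ k, k ≠ i → k ≠ j → a ∉ Γ.ends k := fun k hki hkj hak =>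
      (hΓ.eq_or_eq hji.symm haei hwej hak).elim hki hkj
    have hunion : range (Γ.arc i) ∪ range (Γ.arc j) = univ := by
      have hcl : ∀ k, IsClosed (range (Γ.arc k)) := fun k => (isClosedEmbedding_arc k).isClosed_range
      -- Both ends are used up by `A_i` and `A_j`, so no other arc touches the union: its complement
      -- is the finite union of the remaining arcs.
      refine IsClopen.eq_univ ⟨(hcl i).union (hcl j), ?_⟩ ⟨v, Or.inl (ends_subset_range i hv1)⟩
      have : range (Γ.arc i) ∪ range (Γ.arc j) =
          (⋃ k : {k // k ≠ i ∧ k ≠ j}, range (Γ.arc k))ᶜ := by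
        ext x
        constructor
        · intro hx hx'
          obtain ⟨⟨k, hki, hkj⟩, hk⟩ := mem_iUnion.1 hx'
          have hxk : x ∈ ({a, v} : Set X) ∧ x ∈ Γ.ends k := by
            rcases hx with hx | hx
            · rw [← hai]
              exact mem_ends_of_mem_range hki.symm hx hk
            · rw [← hwj]
              exact mem_ends_of_mem_range hkj.symm hx hk
          rcases hxk with ⟨rfl | rfl, hxk⟩
          · exact hak k hki hkj hxk
          · exact hvk k hki hkj hxk
        · intro hx
          obtain ⟨k, hk⟩ := Γ.exists_mem_range x
          by_cases hki : k = i
          · exact Or.inl (hki ▸ hk)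
          by_cases hkj : k = j
          · exact Or.inr (hkj ▸ hk)
          exact absurd (mem_iUnion.2 ⟨⟨k, hki, hkj⟩, hk⟩) hx
      rw [this]
      exact (isClosed_iUnion_of_finite fun k : {k // k ≠ i ∧ k ≠ j} => hcl k).isOpen_compl
    refine (p.trans q).nonempty_homeomorph_circle ?_ ?_
    · rw [← range_eq_univ, Path.trans_range, hpr, hqr, hunion]
    · refine fun s t => Path.eq_zero_and_eq_one_of_trans_eq hp hq fun x y hxy => ?_
      rcases (hpq (p x) (mem_range_self x) (hxy ▸ mem_range_self y)).1 with h | h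
      · exact Or.inr ⟨hp (h.trans p.source.symm), hq (hxy.symm.trans (h.trans q.target.symm))⟩
      · exact Or.inl ⟨hp (h.trans p.target.symm), hq (hxy.symm.trans (h.trans q.source.symm))⟩
  · right
    have hemb : IsEmbedding (p.trans q) := by
      refine ((p.trans q).continuous.isClosedEmbedding ?_).isEmbedding
      refine Path.injective_trans hp hq (fun x hx => ?_) haw
      obtain ⟨rfl | h, h'⟩ := hpq x hx.1 hx.2
      · rcases h' with h' | h'
        · exact absurd h' haw
        · exact h'
      · exact h
    have hrange : range (p.trans q) = range (Γ.arc i) ∪ range (Γ.arc j) := by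
      rw [Path.trans_range, hpr, hqr]
    let Γ' := Γ.merge hji.symm (p.trans q) hemb hrange (by
      rintro l hli hlj x ⟨hx, hxl⟩
      rw [(p.trans q).source, (p.trans q).target]
      have hxv : x ≠ v := fun h => hvk l hli hlj (h ▸ hxl)
      rw [hai, hwj] at hx
      rcases hx with (h | h) | (h | h)
      exacts [Or.inl h, absurd h hxv, Or.inr h, absurd h hxv])
    have hends_i : Γ'.ends ⟨i, hji.symm⟩ = {a, w} := by
      simp [Γ', ends, merge]
    have hends : ∀ k (hk : k ≠ j), k ≠ i → Γ'.ends ⟨k, hk⟩ = Γ.ends k := by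
      intro k hk hki
      simp [Γ', ends, merge, hki]
    have hai' : a ∉ Γ.ends j := by
      rw [hwj]
      rintro (h | h)
      exacts [haw h, hav h]
    have hwi' : w ∉ Γ.ends i := by
      rw [hai]
      rintro (h | h)
      exacts [haw h.symm, hwv h]
    refine ⟨j, Γ', ?_⟩
    -- Apart from the vanished vertex `v`, the only change is that `i` takes over the end `w` of
    -- `j`.
    have key : ∀ x, x ≠ v → ∀ (k : ι) (hk : k ≠ j),
        x ∈ Γ'.ends ⟨k, hk⟩ ↔ x ∈ Γ.ends k ∨ (k = i ∧ x = w) := by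
      intro x hxv k hk
      by_cases hki : k = i
      · subst hki
        rw [hends_i, hai]
        simp [hxv]
      · rw [hends k hk hki]
        simp [hki]
    have hv' : ∀ k, v ∉ Γ'.ends k := by
      rintro ⟨k, hk⟩
      by_cases hki : k = i
      · subst hki
        rw [hends_i]
        rintro (h | h)
        exacts [hav h.symm, hwv h.symm]
      · rw [hends k hk hki]
        exact hvk k hki hk
    rintro ⟨k, hk⟩ x hx
    have hxv : x ≠ v := fun h => hv' _ (h ▸ hx)
    by_cases hxw : x = w
    · subst hxw
      -- The old partner `l` of `j` at `w` is now paired with `i`.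
      obtain ⟨l, hlj, hxl, hl⟩ := hΓ j x hwej
      have hli : l ≠ i := fun h => hwi' (h ▸ hxl)
      have hmem : ∀ (m : ι) (hm : m ≠ j), x ∈ Γ'.ends ⟨m, hm⟩ ↔ m = l ∨ m = i := by
        intro m hm
        rw [key x hxv]
        constructor
        · rintro (h | h)
          · exact Or.inl ((hl m h).resolve_left hm)
          · exact Or.inr h.1
        · rintro (rfl | rfl)
          · exact Or.inl hxl
          · exact Or.inr ⟨rfl, rfl⟩
      rcases (hmem k hk).1 hx with rfl | rfl
      · refine ⟨⟨i, hji.symm⟩, fun h => hli (congrArg Subtype.val h).symm,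
          (hmem _ _).2 (Or.inr rfl), fun m hm => ?_⟩
        exact ((hmem m.1 m.2).1 hm).imp Subtype.ext Subtype.ext
      · refine ⟨⟨l, hlj⟩, fun h => hli (congrArg Subtype.val h),
          (hmem _ _).2 (Or.inl rfl), fun m hm => ?_⟩
        exact (((hmem m.1 m.2).1 hm).imp Subtype.ext Subtype.ext).symm
    · have hmem : ∀ (m : ι) (hm : m ≠ j), x ∈ Γ'.ends ⟨m, hm⟩ ↔ x ∈ Γ.ends m := by
        intro m hm
        rw [key x hxv]
        simp [hxw]
      have hxj : x ∉ Γ.ends j := by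
        rw [hwj]
        rintro (h | h)
        exacts [hxw h, hxv h]
      obtain ⟨l, hlk, hxl, hl⟩ := hΓ k x ((hmem k hk).1 hx)
      have hlj : l ≠ j := fun h => hxj (h ▸ hxl)
      refine ⟨⟨l, hlj⟩, fun h => hlk (congrArg Subtype.val h), (hmem _ _).2 hxl, fun m hm => ?_⟩
      exact (hl m.1 ((hmem m.1 m.2).1 hm)).imp Subtype.ext Subtype.ext

theorem EndsPaired.nonempty_homeomorph_circle [Finite ι] [T2Space X] [ConnectedSpace X]
    (hΓ : Γ.EndsPaired) : Nonempty (X ≃ₜ Circle) := by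
  induction hn : Nat.card ι using Nat.strong_induction_on generalizing ι with
  | _ n ih =>
    obtain ⟨x⟩ := (inferInstance : Nonempty X)
    obtain ⟨i, -⟩ := Γ.exists_mem_range x
    rcases hΓ.nonempty_homeomorph_circle_or_exists i with h | ⟨j, Γ', hΓ'⟩
    · exact h
    · exact ih _ (hn ▸ Finite.card_subtype_lt (x := j) (by simp)) hΓ' rfl

theorem infinite_of_nonempty [Nonempty X] (Γ : ArcDecomposition ι X) : Infinite X := by
  obtain ⟨x⟩ := (inferInstance : Nonempty X)
  obtain ⟨i, -⟩ := Γ.exists_mem_range x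
  have : Infinite unitInterval := Set.infinite_coe_iff.2 (Set.Icc_infinite zero_lt_one)
  exact Infinite.of_injective _ (Γ.arc_injective i)

end ArcDecomposition

end

theorem mainTheorem3 {X : Type*} [MetricSpace X] [CompactSpace X] [ConnectedSpace X]
    {ι : Type*} [Finite ι] (Γ : ArcDecomposition ι X) :
    List.TFAE [
      Nonempty (X ≃ₜ Circle),
      possibleHeights X = Set.range (fun n : ℕ => (n : ℕ∞)) ∪ {⊤},
      (0 : ℕ∞) ∈ possibleHeights X,
      ∀ v ∈ Γ.vertices, Γ.degree v = 2] := by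
  have : Infinite X := Γ.infinite_of_nonempty
  tfae_have 1 → 2 := by
    rintro ⟨e⟩
    have huniv : Set.range (fun n : ℕ => (n : ℕ∞)) ∪ {⊤} = Set.univ := by
      refine Set.eq_univ_of_forall fun h => ?_
      induction h using ENat.recTopCoe with
      | top => exact Or.inr rfl
      | coe n => exact Or.inl ⟨n, rfl⟩
    rw [huniv]
    refine Set.eq_univ_of_forall fun h => ?_
    induction h using ENat.recTopCoe with
    | top => exact top_mem_possibleHeights
    | coe n => exact natCast_mem_possibleHeights_of_homeomorph_circle e n
  tfae_have 2 → 3 := by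
    intro h
    rw [h]
    exact Or.inl ⟨0, rfl⟩
  tfae_have 3 → 4 := fun h v hv => ArcDecomposition.degree_eq_two_of_zero_mem_possibleHeights h hv
  tfae_have 4 → 1 := fun h =>
    (ArcDecomposition.endsPaired_of_degree_eq_two h).nonempty_homeomorph_circle
  tfae_finish
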